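/- All graphs are finite, simple and undirected. A tree decomposition of a graph $G$ is a pair $(T,\{X_t : t\in V(T)\})$ where $T$ is a tree and $X_t\subseteq V(G)$ for each $t$, such that $\bigcup_t X_t=V(G)$, for each edge $uv$ of $G$ some $X_t$ contains both $u$ and $v$, and for each $u\in V(G)$ the set $\{t\in V(T) : u\in X_t\}$ induces a connected subtree of $T$. Its width is $\max_t |X_t|-1$, and the treewidth $\mathrm{tw}(G)$ is the minimum width of a tree decomposition of $G$ (with the convention that the graph without vertices has treewidth $0$). The clique number $\omega(G)$ is the maximum size of a clique in $G$. A graph is $H$-subgraph-free if it has no (not necessarily induced) subgraph isomorphic to $H$. A class $\mathcal{G}$ of graphs is $(\mathrm{tw},\omega)$-bounded if there is a function $f:\mathbb{N}\to\mathbb{N}$ such that $\mathrm{tw}(G')\le f(\omega(G'))$ for every $G\in\mathcal{G}$ and every induced subgraph $G'$ of $G$; it has bounded treewidth if there is a constant $c$ such that $\mathrm{tw}(G)\le c$ for all $G\in\mathcal{G}$. A subdivided claw is a graph obtained from the claw $K_{1,3}$ by replacing each edge with a path of length at least one. Let $\mathcal{S}$ be the class of graphs in which every connected component is either a path (possibly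 with a single vertex) or a subdivided claw. **Theorem.** For every graph $H$, the following conditions are equivalent. 1. The class of $H$-subgraph-free graphs is $(\mathrm{tw},\omega)$-bounded. 2. The class of $H$-subgraph-free graphs has bounded treewidth. 3. $H\in\mathcal{S}$. -/

import Mathlib

universe u

namespace TwOmega

/-- A tree decomposition of a graph `G`: a (finite) tree together with a bag of vertices of `G` for
each node of the tree, such that the bags cover all vertices and all edges, and the nodes whose bags
contain a given vertex induce a connected subtree. -/
structure TreeDecomposition {V : Type u} (G : SimpleGraph V) where
  /-- the nodes of the tree -/
  Node : Type
  finite_node : Finite Node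
  /-- the tree -/
  tree : SimpleGraph Node
  isTree : tree.IsTree
  /-- the bags -/
  bag : Node → Finset V
  vertex_mem : ∀ v : V, ∃ t, v ∈ bag t
  edge_mem : ∀ ⦃v w : V⦄, G.Adj v w → ∃ t, v ∈ bag t ∧ w ∈ bag t
  connected : ∀ v : V, (tree.induce {t | v ∈ bag t}).Connected

/-- The width of a tree decomposition: the largest size of a bag, minus one. The subtraction
truncates only if all bags are empty, that is, only for a graph without vertices. -/
noncomputable def TreeDecomposition.width {V : Type u} {G : SimpleGraph V}
    (D : TreeDecomposition G) : ℕ :=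
  (⨆ t : D.Node, (D.bag t).card) - 1

/-- The treewidth of a finite graph: the minimum width of a tree decomposition
(`0` for the graph without vertices). -/
noncomputable def treewidth {V : Type u} (G : SimpleGraph V) : ℕ :=
  sInf {k : ℕ | ∃ D : TreeDecomposition G, D.width = k}

/-- A class of finite graphs. -/
abbrev GraphClass : Type (u + 1) := ∀ (V : Type u) [Finite V], SimpleGraph V → Prop

/-- A graph class is `(tw, ω)`-bounded if there is a function `f` such that
`tw(G') ≤ f(ω(G'))` for every induced subgraph `G'` of every graph in the class. -/
def IsTwOmegaBounded (𝒢 : GraphClass.{u}) : Prop :=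
  ∃ f : ℕ → ℕ, ∀ (V : Type u) [Finite V] (G : SimpleGraph V), 𝒢 V G →
    ∀ s : Set V, treewidth (G.induce s) ≤ f (G.induce s).cliqueNum

/-- A graph class has bounded treewidth if some constant bounds the treewidth of all its members. -/
def HasBoundedTreewidth (𝒢 : GraphClass.{u}) : Prop :=
  ∃ c : ℕ, ∀ (V : Type u) [Finite V] (G : SimpleGraph V), 𝒢 V G → treewidth G ≤ c

/-- The class of finite graphs that do not contain `H` as a (not necessarily induced) subgraph. -/
def subgraphFree {W : Type u} (H : SimpleGraph W) : GraphClass.{u} :=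
  fun _ _ G => H.Free G

/-- The graph obtained from the claw `K_{1,3}` by replacing its `i`-th edge with a path of length
`ℓ i` (for `ℓ i ≥ 1`): `none` is the center, and `some ⟨i, j⟩` is the vertex at distance `j + 1`
from the center on the `i`-th path. -/
def subdividedClaw (ℓ : Fin 3 → ℕ) : SimpleGraph (Option (Σ i : Fin 3, Fin (ℓ i))) :=
  SimpleGraph.fromRel fun
    | none, some ⟨_, j⟩ => (j : ℕ) = 0
    | some ⟨i, j⟩, some ⟨i', j'⟩ => i = i' ∧ (j' : ℕ) = (j : ℕ) + 1
    | _, none => False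

/-- A graph is a path if it is isomorphic to the path on `n` vertices for some `n ≥ 1`. -/
def IsPathGraph {V : Type u} (G : SimpleGraph V) : Prop :=
  ∃ n : ℕ, 1 ≤ n ∧ Nonempty (G ≃g SimpleGraph.pathGraph n)

/-- A graph is a subdivided claw if it is obtained, up to isomorphism, from the claw by replacing
each edge with a path of length at least one. -/
def IsSubdividedClaw {V : Type u} (G : SimpleGraph V) : Prop :=
  ∃ ℓ : Fin 3 → ℕ, (∀ i, 1 ≤ ℓ i) ∧ Nonempty (G ≃g subdividedClaw ℓ)

/-- Membership in the class `𝒮`: every connected component is a path or a subdivided claw. -/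
def MemS {V : Type u} (G : SimpleGraph V) : Prop :=
  ∀ C : G.ConnectedComponent, IsPathGraph C.toSimpleGraph ∨ IsSubdividedClaw C.toSimpleGraph

end TwOmega

/-! If `H` lies in `𝒮`, then `H` is contained in a disjoint union of sufficiently many large
subdivided claws. So in an `H`-free graph, a maximal family of disjoint copies of such a claw covers
boundedly many vertices, and deleting them leaves a graph without the claw. An edge of that graph
between two vertices far apart on a branch of a depth-first search forest would form a claw together
with the branch, unless its upper end is close to the root. Hence all neighbours of a vertex among
its ancestors are close to it or close to the root, which makes the forest a tree decomposition of
bounded width.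

Conversely, link claws with long legs at their tips in the pattern of a large grid. The crosses
formed by a row and a column are a bramble, so the resulting graph has large treewidth, and contains
`H` if `H`-free graphs have bounded treewidth. A component of `H` is too small to leave the
neighbourhood of a single claw, in which every leg is merely prolonged by the leg linked to it, so
it is a path or a subdivided claw.

Finally, the clique number of an `H`-free graph is less than the number of vertices of `H`. -/

namespace TwOmega

open SimpleGraph

universe v w

/-! ### Acyclic graphs and paths -/

theorem exists_boundary_adj {V : Type v} {G : SimpleGraph V} {x y : V} (h : G.Reachable x y)
    {S : Set V} (hx : x ∈ S) (hy : y ∉ S) : ∃ z ∈ S, ∃ w ∉ S, G.Adj z w := by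
  obtain ⟨p⟩ := h
  obtain ⟨d, -, hfst, hsnd⟩ := p.exists_boundary_dart S hx hy
  exact ⟨d.fst, hfst, d.snd, hsnd, d.adj⟩

theorem adj_copy_iff_of_isAcyclic {V : Type v} {W : Type w} {G : SimpleGraph V}
    {T : SimpleGraph W} (hG : G.Preconnected) (hT : T.IsAcyclic) (f : G.Copy T) {x y : V} :
    T.Adj (f x) (f y) ↔ G.Adj x y := by
  refine ⟨fun h => ?_, fun h => f.toHom.map_adj h⟩
  obtain ⟨p, hp⟩ := (hG x y).exists_isPath
  have hpath : (p.map f.toHom).IsPath := hp.map f.injective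
  have hedge : p.map f.toHom = h.toWalk :=
    congrArg Subtype.val ((isAcyclic_iff_subsingleton_path.1 hT (f x) (f y)).elim
      ⟨p.map f.toHom, hpath⟩ (Path.singleton h))
  refine p.adj_of_length_eq_one ?_
  rw [← p.length_map f.toHom, hedge, Walk.length_cons, Walk.length_nil]

theorem nonempty_iso_of_range_eq {U : Type u} {V : Type v} {W : Type w} {F : SimpleGraph U}
    {G : SimpleGraph V} {K : SimpleGraph W} (f : F ↪g K) (g : G ↪g K)
    (h : Set.range f = Set.range g) : Nonempty (F ≃g G) := by
  let e : U ≃ V := (Equiv.ofInjective f f.injective).trans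
    ((Equiv.setCongr h).trans (Equiv.ofInjective g g.injective).symm)
  have he (x : U) : g (e x) = f x :=
    congrArg Subtype.val ((Equiv.ofInjective g g.injective).apply_symm_apply _)
  refine ⟨⟨e, fun {x y} => ?_⟩⟩
  rw [← g.map_adj_iff, he, he, f.map_adj_iff]

section Hasse

variable {α : Type w} [LinearOrder α]

theorem hasse_isAcyclic : (hasse α).IsAcyclic := by
  have key : ∀ a b : α, a ⋖ b → (hasse α).IsBridge s(a, b) := by
    intro a b hab
    rw [isBridge_iff]
    intro hreach
    obtain ⟨z, hza, w, haw, hadj⟩ := exists_boundary_adj hreach (Set.mem_Iic.2 le_rfl)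
      (fun hba => hab.lt.not_ge hba)
    obtain ⟨hzw, hne⟩ := deleteEdges_adj.1 hadj
    rw [Set.mem_Iic, not_le] at haw
    obtain hzw | hwz := hasse_adj.1 hzw
    · obtain rfl : z = a := le_antisymm hza (not_lt.1 fun h => hzw.2 h haw)
      exact hne (by rw [hzw.unique_right hab]; rfl)
    · exact (hwz.lt.trans_le hza).not_gt haw
  refine isAcyclic_iff_forall_adj_isBridge.2 fun a b hab => ?_
  obtain h | h := hasse_adj.1 hab
  exacts [key a b h, Sym2.eq_swap ▸ key b a h]

theorem ordConnected_range_hom_hasse {V : Type v} {G : SimpleGraph V} (hG : G.Preconnected)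
    (f : G →g hasse α) : (Set.range f).OrdConnected := by
  refine ⟨?_⟩
  rintro _ ⟨x, rfl⟩ _ ⟨y, rfl⟩ c ⟨hxc, hcy⟩
  by_cases hyc : f y ≤ c
  · exact ⟨y, hyc.antisymm hcy⟩
  obtain ⟨z, hz, w, hw, hadj⟩ := exists_boundary_adj (hG x y) (S := {z | f z ≤ c}) hxc hyc
  rw [Set.mem_ofPred_eq, not_le] at hw
  obtain hzw | hwz := hasse_adj.1 (f.map_adj hadj)
  · exact ⟨z, le_antisymm hz (not_lt.1 fun h => hzw.2 h hw)⟩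
  · exact absurd hw (hwz.lt.trans_le hz).not_gt

theorem isPathGraph_of_isContained_hasse {V : Type u} [Finite V] {G : SimpleGraph V}
    (hG : G.Connected) (h : G ⊑ hasse α) : IsPathGraph G := by
  classical
  have := Fintype.ofFinite V
  obtain ⟨f⟩ := h
  let F : G ↪g hasse α :=
    ⟨⟨f, f.injective⟩, adj_copy_iff_of_isAcyclic hG.preconnected hasse_isAcyclic f⟩
  let s : Finset α := Finset.univ.map F.toEmbedding
  have hs : (s : Set α) = Set.range F := by simp [s]
  let g : Fin s.card ↪o α := s.orderEmbOfFin rfl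
  have hg : Set.range g = Set.range F := by rw [← hs]; exact s.range_orderEmbOfFin rfl
  have hord : (Set.range g).OrdConnected :=
    hg ▸ ordConnected_range_hom_hasse hG.preconnected F.toHom
  let g' : pathGraph s.card ↪g hasse α := ⟨g.toEmbedding, by
    intro a b
    simp only [pathGraph, hasse_adj]
    exact or_congr (hord.apply_covBy_apply_iff g) (hord.apply_covBy_apply_iff g)⟩
  have := hG.nonempty
  have hcard : s.card ≠ 0 := by simp [s]
  exact ⟨s.card, Nat.one_le_iff_ne_zero.2 hcard, nonempty_iso_of_range_eq F g' hg.symm⟩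

end Hasse

/-! ### Rooted forests -/

/-- A rooted forest, given by the parent and the depth of each vertex. The vertices of depth `0` are
the roots, and the value of `parent` at a root is irrelevant. -/
structure RootedForest (V : Type v) where
  /-- the parent of a vertex that is not a root -/
  parent : V → V
  /-- the distance to the root -/
  depth : V → ℕ
  depth_parent : ∀ ⦃v⦄, depth v ≠ 0 → depth (parent v) + 1 = depth v

namespace RootedForest

variable {V : Type v} (F : RootedForest V)

/-- The graph of a rooted forest: every vertex that is not a root is joined to its parent. -/
def graph : SimpleGraph V :=
  SimpleGraph.fromRel fun v w => F.depth v ≠ 0 ∧ F.parent v = w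

/-- The vertex `u` lies on the path from `v` to its root. -/
def IsAncestor (u v : V) : Prop :=
  ∃ k ≤ F.depth v, F.parent^[k] v = u

variable {F} {u v x : V}

theorem parent_ne (hv : F.depth v ≠ 0) : F.parent v ≠ v := fun h => by
  have := F.depth_parent hv
  rw [h] at this
  omega

theorem graph_adj : F.graph.Adj u v ↔
    (F.depth u ≠ 0 ∧ F.parent u = v) ∨ (F.depth v ≠ 0 ∧ F.parent v = u) := by
  refine (fromRel_adj _ _ _).trans (and_iff_right_of_imp ?_)
  rintro (⟨hu, rfl⟩ | ⟨hv, rfl⟩)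
  exacts [(parent_ne hu).symm, parent_ne hv]

theorem depth_le_depth_add_one (h : F.graph.Adj u v) : F.depth v ≤ F.depth u + 1 := by
  obtain ⟨h0, rfl⟩ | ⟨h0, rfl⟩ := graph_adj.1 h <;>
    · have := F.depth_parent h0
      omega

theorem graph_adj_parent (hv : F.depth v ≠ 0) : F.graph.Adj v (F.parent v) :=
  graph_adj.2 (Or.inl ⟨hv, rfl⟩)

theorem graph_le_iff {G : SimpleGraph V} :
    F.graph ≤ G ↔ ∀ v, F.depth v ≠ 0 → G.Adj v (F.parent v) := by
  refine ⟨fun h v hv => h (graph_adj_parent hv), fun h u v huv => ?_⟩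
  obtain ⟨hu, rfl⟩ | ⟨hv, rfl⟩ := graph_adj.1 huv
  exacts [h u hu, (h v hv).symm]

theorem depth_iterate {k : ℕ} (hk : k ≤ F.depth v) : F.depth (F.parent^[k] v) + k = F.depth v := by
  induction k with
  | zero => rfl
  | succ k ih =>
    have := ih (by omega)
    have := F.depth_parent (v := F.parent^[k] v) (by omega)
    rw [Function.iterate_succ_apply']
    omega

theorem graph_adj_iterate {k : ℕ} (hk : k < F.depth v) :
    F.graph.Adj (F.parent^[k] v) (F.parent^[k + 1] v) := by
  have := depth_iterate hk.le
  rw [Function.iterate_succ_apply']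
  exact graph_adj_parent (by omega)

theorem injOn_iterate : Set.InjOn (fun k => F.parent^[k] v) (Set.Iic (F.depth v)) := by
  intro a ha b hb hab
  have hda := depth_iterate (Set.mem_Iic.1 ha)
  have hdb := depth_iterate (Set.mem_Iic.1 hb)
  have : F.depth (F.parent^[a] v) = F.depth (F.parent^[b] v) := congrArg F.depth hab
  omega

theorem depth_lt_card [Finite V] (v : V) : F.depth v < Nat.card V := by
  have := Nat.card_le_card_of_injective
    (fun k : Fin (F.depth v + 1) => F.parent^[(k : ℕ)] v) fun a b hab =>
      Fin.ext (injOn_iterate (Nat.lt_succ_iff.1 a.2) (Nat.lt_succ_iff.1 b.2) hab)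
  simpa using this

theorem IsAncestor.refl (v : V) : F.IsAncestor v v := ⟨0, Nat.zero_le _, rfl⟩

theorem IsAncestor.depth_le (h : F.IsAncestor u v) : F.depth u ≤ F.depth v := by
  obtain ⟨k, hk, rfl⟩ := h
  have := depth_iterate hk
  omega

theorem IsAncestor.iterate_eq (h : F.IsAncestor u v) :
    F.parent^[F.depth v - F.depth u] v = u := by
  obtain ⟨k, hk, rfl⟩ := h
  rw [← depth_iterate hk, Nat.add_sub_cancel_left]

theorem IsAncestor.eq_of_depth_eq {w : V} (hu : F.IsAncestor u v) (hw : F.IsAncestor w v)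
    (h : F.depth u = F.depth w) : u = w := by
  rw [← hu.iterate_eq, h, hw.iterate_eq]

theorem isAncestor_of_isAncestor_parent (hv : F.depth v ≠ 0) (h : F.IsAncestor u (F.parent v)) :
    F.IsAncestor u v := by
  obtain ⟨k, hk, hku⟩ := h
  have := F.depth_parent hv
  exact ⟨k + 1, by omega, hku⟩

theorem IsAncestor.depth_ne_zero (h : F.IsAncestor u v) (huv : u ≠ v) : F.depth v ≠ 0 := by
  obtain ⟨k, hk, rfl⟩ := h
  rintro h0
  obtain rfl : k = 0 := by omega
  exact huv rfl

theorem IsAncestor.parent (h : F.IsAncestor u v) (huv : u ≠ v) : F.IsAncestor u (F.parent v) := by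
  have := F.depth_parent (h.depth_ne_zero huv)
  obtain ⟨k | k, hk, hku⟩ := h
  · exact absurd hku.symm huv
  · exact ⟨k, by omega, hku⟩

theorem isAncestor_parent_iff (hv : F.depth v ≠ 0) (huv : u ≠ v) :
    F.IsAncestor u (F.parent v) ↔ F.IsAncestor u v :=
  ⟨isAncestor_of_isAncestor_parent hv, fun h => h.parent huv⟩

theorem eq_and_parent_eq_of_graph_adj {z w : V} (h : F.graph.Adj z w) (hz : F.IsAncestor x z)
    (hw : ¬ F.IsAncestor x w) : z = x ∧ F.parent x = w := by
  obtain ⟨-, rfl⟩ | ⟨hw0, rfl⟩ := graph_adj.1 h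
  · by_cases hxz : x = z
    · exact ⟨hxz.symm, hxz ▸ rfl⟩
    · exact absurd (hz.parent hxz) hw
  · exact absurd (isAncestor_of_isAncestor_parent hw0 hz) hw

theorem graph_isAcyclic (F : RootedForest V) : F.graph.IsAcyclic := by
  have key : ∀ x, F.depth x ≠ 0 → F.graph.IsBridge s(x, F.parent x) := by
    intro x hx
    rw [isBridge_iff]
    intro hreach
    have hparent : ¬ F.IsAncestor x (F.parent x) := fun h => by
      have := h.depth_le
      have := F.depth_parent hx
      omega
    obtain ⟨z, hz, w, hw, hadj⟩ :=
      exists_boundary_adj hreach (S := {z | F.IsAncestor x z}) (IsAncestor.refl x) hparent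
    obtain ⟨hzw, hne⟩ := deleteEdges_adj.1 hadj
    obtain ⟨rfl, rfl⟩ := eq_and_parent_eq_of_graph_adj hzw hz hw
    exact hne rfl
  refine isAcyclic_iff_forall_adj_isBridge.2 fun x y hxy => ?_
  obtain ⟨hx, rfl⟩ | ⟨hy, rfl⟩ := graph_adj.1 hxy
  exacts [key x hx, Sym2.eq_swap ▸ key y hy]

theorem induce_graph_connected {S : Set V} {t : V} (ht : t ∈ S)
    (hS : ∀ x ∈ S, x ≠ t → F.depth x ≠ 0 ∧ F.parent x ∈ S) : (F.graph.induce S).Connected := by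
  have key : ∀ n x (hx : x ∈ S), F.depth x = n →
      (F.graph.induce S).Reachable ⟨x, hx⟩ ⟨t, ht⟩ := by
    intro n
    induction n using Nat.strong_induction_on with
    | _ n ih =>
      intro x hx hn
      by_cases hxt : x = t
      · subst hxt; exact Reachable.refl _
      · obtain ⟨hx0, hpx⟩ := hS x hx hxt
        have := F.depth_parent hx0
        have hadj : (F.graph.induce S).Adj ⟨x, hx⟩ ⟨F.parent x, hpx⟩ := graph_adj_parent hx0
        exact hadj.reachable.trans (ih _ (by omega) _ hpx rfl)
  exact (connected_iff _).2
    ⟨fun x y => (key _ x x.2 rfl).trans (key _ y y.2 rfl).symm, ⟨⟨t, ht⟩⟩⟩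

theorem graph_connected {t : V} (h : ∀ x, x ≠ t → F.depth x ≠ 0) : F.graph.Connected :=
  (induceUnivIso _).connected_iff.1 <|
    induce_graph_connected (Set.mem_univ t) fun x _ hx => ⟨h x hx, Set.mem_univ _⟩

/-- The rooted tree obtained from a rooted forest by joining all roots to a new root `none`. -/
def addRoot (F : RootedForest V) : RootedForest (Option V) where
  parent x := x.elim none fun v => if F.depth v = 0 then none else some (F.parent v)
  depth x := x.elim 0 fun v => F.depth v + 1
  depth_parent := by
    rintro (_ | v) hv
    · exact absurd rfl hv
    · by_cases h0 : F.depth v = 0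
      · simp [h0]
      · simp [h0, F.depth_parent h0]

theorem addRoot_parent_some (hv : F.depth v ≠ 0) : F.addRoot.parent (some v) = some (F.parent v) :=
  if_neg hv

theorem addRoot_isTree (F : RootedForest V) : F.addRoot.graph.IsTree := by
  refine ⟨graph_connected (t := none) fun x hx => ?_, F.addRoot.graph_isAcyclic⟩
  obtain ⟨v, rfl⟩ := Option.ne_none_iff_exists'.1 hx
  exact Nat.succ_ne_zero _

/-- A rooted forest `F` is a normal spanning forest of `G` if it is a subgraph of `G` and adjacent
vertices of `G` always lie on a common branch of `F`; depth-first search produces such forests. -/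
structure IsNormal (F : RootedForest V) (G : SimpleGraph V) : Prop where
  graph_le : F.graph ≤ G
  comparable : ∀ ⦃u v⦄, G.Adj u v → F.IsAncestor u v ∨ F.IsAncestor v u

open Classical in
/-- The rooted forest obtained by making `v` the parent of `u`, which moves the subtree at `u`
downwards. -/
noncomputable def reattach (F : RootedForest V) (u v : V) (hdepth : F.depth u ≤ F.depth v)
    (hanc : ¬ F.IsAncestor u v) : RootedForest V where
  parent := Function.update F.parent u v
  depth w := if F.IsAncestor u w then F.depth w + (F.depth v + 1 - F.depth u) else F.depth w
  depth_parent w hw := by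
    by_cases hwu : w = u
    · subst hwu
      rw [Function.update_self, if_neg hanc, if_pos (IsAncestor.refl w)]
      omega
    · rw [Function.update_of_ne hwu]
      have h0 : F.depth w ≠ 0 := fun h0 => hw <| by
        rw [if_neg fun h => h.depth_ne_zero (Ne.symm hwu) h0, h0]
      have := F.depth_parent h0
      simp only [isAncestor_parent_iff h0 (Ne.symm hwu)]
      split_ifs <;> omega

theorem sum_depth_lt_sum_depth_reattach [Fintype V] (hdepth : F.depth u ≤ F.depth v)
    (hanc : ¬ F.IsAncestor u v) :
    ∑ w, F.depth w < ∑ w, (F.reattach u v hdepth hanc).depth w := by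
  have hu : F.depth u < (F.reattach u v hdepth hanc).depth u := by
    simp only [reattach, if_pos (IsAncestor.refl u)]
    omega
  refine Finset.sum_lt_sum (fun w _ => ?_) ⟨u, Finset.mem_univ _, hu⟩
  simp only [reattach]
  split_ifs <;> omega

theorem reattach_graph_le {G : SimpleGraph V} (hF : F.graph ≤ G) (huv : G.Adj u v)
    (hdepth : F.depth u ≤ F.depth v) (hanc : ¬ F.IsAncestor u v) :
    (F.reattach u v hdepth hanc).graph ≤ G := by
  classical
  refine graph_le_iff.2 fun w hw => ?_
  by_cases hwu : w = u
  · subst hwu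
    simpa [reattach] using huv
  · have h0 : F.depth w ≠ 0 := fun h0 => hw <| by
      simpa only [reattach, if_neg fun h => IsAncestor.depth_ne_zero h (Ne.symm hwu) h0] using h0
    simpa only [reattach, Function.update_of_ne hwu] using graph_le_iff.1 hF w h0

/-- Reattaching subtrees shows that a spanning forest with the largest sum of depths is normal. -/
theorem exists_isNormal [Finite V] (G : SimpleGraph V) : ∃ F : RootedForest V, F.IsNormal G := by
  have := Fintype.ofFinite V
  let A : Set ℕ := {n | ∃ F : RootedForest V, F.graph ≤ G ∧ ∑ v, F.depth v = n}
  have hne : A.Nonempty :=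
    ⟨_, ⟨id, fun _ => 0, fun _ h => absurd rfl h⟩, graph_le_iff.2 fun _ h => absurd rfl h, rfl⟩
  have hbdd : BddAbove A := by
    refine ⟨∑ _v : V, Nat.card V, ?_⟩
    rintro n ⟨F, -, rfl⟩
    exact Finset.sum_le_sum fun v _ => (F.depth_lt_card v).le
  obtain ⟨F, hF, hmax⟩ := Nat.sSup_mem hne hbdd
  have hanc : ∀ u v, G.Adj u v → F.depth u ≤ F.depth v → F.IsAncestor u v := by
    intro u v huv hdepth
    by_contra hanc
    have hle := le_csSup hbdd ⟨_, reattach_graph_le hF huv hdepth hanc, rfl⟩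
    exact hle.not_gt (hmax ▸ sum_depth_lt_sum_depth_reattach hdepth hanc)
  refine ⟨F, hF, fun u v huv => ?_⟩
  exact (le_total (F.depth u) (F.depth v)).imp (hanc u v huv) (hanc v u huv.symm)

end RootedForest

/-! ### Upper bounds for the treewidth -/

section Decomposition

variable {V : Type u} {G : SimpleGraph V}

theorem TreeDecomposition.treewidth_le (D : TreeDecomposition G) {k : ℕ}
    (hk : ∀ t, (D.bag t).card ≤ k + 1) : treewidth G ≤ k := by
  have := D.isTree.connected.nonempty
  have hwidth : treewidth G ≤ D.width := Nat.sInf_le ⟨D, rfl⟩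
  exact hwidth.trans (Nat.sub_le_of_le_add (ciSup_le hk))

theorem treewidth_le_of_isTree {N : Type v} [Finite N] {T : SimpleGraph N} (hT : T.IsTree)
    (bag : N → Finset V) (hvertex : ∀ v, ∃ t, v ∈ bag t)
    (hedge : ∀ ⦃v w⦄, G.Adj v w → ∃ t, v ∈ bag t ∧ w ∈ bag t)
    (hconn : ∀ v, (T.induce {t | v ∈ bag t}).Connected) {k : ℕ} (hk : ∀ t, (bag t).card ≤ k + 1) :
    treewidth G ≤ k := by
  let e := (Finite.equivFin N).symm
  have hbag (P : Finset V → Prop) (h : ∃ t, P (bag t)) : ∃ i, P (bag (e i)) :=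
    e.exists_congr_left.2 (by simpa using h)
  let D : TreeDecomposition G :=
    { Node := Fin (Nat.card N)
      finite_node := inferInstance
      tree := T.comap e
      isTree := (Iso.comap e T).isTree_iff.2 hT
      bag := fun i => bag (e i)
      vertex_mem := fun v => hbag (v ∈ ·) (hvertex v)
      edge_mem := fun v w h => hbag (fun s => v ∈ s ∧ w ∈ s) (hedge h)
      connected := fun v =>
        let f : (T.comap e).induce {i | v ∈ bag (e i)} ≃g T.induce {t | v ∈ bag t} :=
          ⟨e.subtypeEquiv fun _ => Iff.rfl, Iff.rfl⟩
        f.connected_iff.2 (hconn v) }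
  exact D.treewidth_le fun i => hk (e i)

theorem nonempty_treeDecomposition [Finite V] (G : SimpleGraph V) :
    Nonempty (TreeDecomposition G) := by
  have := Fintype.ofFinite V
  exact ⟨{
    Node := Unit
    finite_node := inferInstance
    tree := ⊥
    isTree := IsTree.of_subsingleton
    bag := fun _ => Finset.univ
    vertex_mem := fun v => ⟨(), Finset.mem_univ v⟩
    edge_mem := fun v w _ => ⟨(), Finset.mem_univ v, Finset.mem_univ w⟩
    connected := fun v =>
      (connected_iff _).2 ⟨Preconnected.of_subsingleton, ⟨⟨(), Finset.mem_univ v⟩⟩⟩ }⟩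

theorem exists_card_bag_le_treewidth_add_one [Finite V] (G : SimpleGraph V) :
    ∃ D : TreeDecomposition G, ∀ t, (D.bag t).card ≤ treewidth G + 1 := by
  obtain ⟨D₀⟩ := nonempty_treeDecomposition G
  obtain ⟨D, hD⟩ := Nat.sInf_mem (s := {k | ∃ D : TreeDecomposition G, D.width = k}) ⟨_, D₀, rfl⟩
  have := D.finite_node
  have hwidth : (⨆ t : D.Node, (D.bag t).card) - 1 = treewidth G := hD
  refine ⟨D, fun t => ?_⟩
  have := le_ciSup (f := fun t => (D.bag t).card) (Set.finite_range _).bddAbove t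
  omega

theorem treewidth_le_of_iso {V' : Type v} [Finite V] {G' : SimpleGraph V'} (e : G ≃g G') :
    treewidth G' ≤ treewidth G := by
  obtain ⟨D, hD⟩ := exists_card_bag_le_treewidth_add_one G
  have := D.finite_node
  let bag (t : D.Node) : Finset V' := (D.bag t).map e.toEquiv.toEmbedding
  have hbag (v : V') (t : D.Node) : v ∈ bag t ↔ e.symm v ∈ D.bag t := Finset.mem_map_equiv
  refine treewidth_le_of_isTree D.isTree bag (fun v => ?_) (fun v w h => ?_) (fun v => ?_)
    fun t => (Finset.card_map _).trans_le (hD t)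
  · simpa only [hbag] using D.vertex_mem (e.symm v)
  · simpa only [hbag] using D.edge_mem (e.symm.map_adj_iff.2 h)
  · have hnodes : {t | v ∈ bag t} = {t | e.symm v ∈ D.bag t} := Set.ext (hbag v)
    exact hnodes ▸ D.connected (e.symm v)

theorem treewidth_le_treewidth_induce_compl_add_card [Finite V] (X : Finset V) :
    treewidth G ≤ treewidth (G.induce (X : Set V)ᶜ) + X.card := by
  classical
  obtain ⟨D, hD⟩ := exists_card_bag_le_treewidth_add_one (G.induce (X : Set V)ᶜ)
  have := D.finite_node
  obtain ⟨t₀⟩ := D.isTree.connected.nonempty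
  let bag (t : D.Node) : Finset V := (D.bag t).map (.subtype _) ∪ X
  have hX {v : V} (hv : v ∈ X) (t : D.Node) : v ∈ bag t := Finset.mem_union_right _ hv
  have hbag {v : V} (hv : v ∉ X) (t : D.Node) : v ∈ bag t ↔ ⟨v, hv⟩ ∈ D.bag t := by
    simp [bag, hv]
  refine treewidth_le_of_isTree D.isTree bag (fun v => ?_) (fun v w h => ?_) (fun v => ?_)
    fun t => ?_
  · by_cases hv : v ∈ X
    · exact ⟨t₀, hX hv t₀⟩
    · simpa only [hbag hv] using D.vertex_mem ⟨v, hv⟩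
  · by_cases hv : v ∈ X <;> by_cases hw : w ∈ X
    · exact ⟨t₀, hX hv t₀, hX hw t₀⟩
    · simpa only [hX hv, hbag hw, true_and] using D.vertex_mem ⟨w, hw⟩
    · simpa only [hbag hv, hX hw, and_true] using D.vertex_mem ⟨v, hv⟩
    · simpa only [hbag hv, hbag hw] using D.edge_mem (v := ⟨v, hv⟩) (w := ⟨w, hw⟩) h
  · by_cases hv : v ∈ X
    · have hnodes : {t | v ∈ bag t} = Set.univ := Set.eq_univ_of_forall (hX hv)
      exact hnodes ▸ (induceUnivIso D.tree).connected_iff.2 D.isTree.connected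
    · have hnodes : {t | v ∈ bag t} = {t | ⟨v, hv⟩ ∈ D.bag t} := Set.ext (hbag hv)
      exact hnodes ▸ D.connected ⟨v, hv⟩
  · calc (bag t).card ≤ ((D.bag t).map (.subtype _)).card + X.card := Finset.card_union_le _ _
      _ ≤ treewidth (G.induce (X : Set V)ᶜ) + 1 + X.card := by
        rw [Finset.card_map]
        exact Nat.add_le_add_right (hD t) _
      _ = treewidth (G.induce (X : Set V)ᶜ) + X.card + 1 := Nat.add_right_comm _ _ _

theorem RootedForest.IsNormal.treewidth_le [Finite V] {F : RootedForest V} (hF : F.IsNormal G)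
    (bag : V → Finset V) (hself : ∀ v, v ∈ bag v)
    (hanc : ∀ ⦃u v⦄, u ∈ bag v → F.IsAncestor u v)
    (hparent : ∀ ⦃u v⦄, u ∈ bag v → u ≠ v → u ∈ bag (F.parent v))
    (hadj : ∀ ⦃u v⦄, G.Adj u v → F.IsAncestor u v → u ∈ bag v) {k : ℕ}
    (hk : ∀ v, (bag v).card ≤ k + 1) : treewidth G ≤ k := by
  refine treewidth_le_of_isTree F.addRoot_isTree (fun x => x.elim ∅ bag)
    (fun v => ⟨some v, hself v⟩) (fun u v huv => ?_) (fun u => ?_) ?_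
  · obtain h | h := hF.comparable huv
    exacts [⟨some v, hadj huv h, hself v⟩, ⟨some u, hself u, hadj huv.symm h⟩]
  · refine induce_graph_connected (t := some u) (hself u) ?_
    rintro (_ | v) hv hvu
    · exact absurd hv (Finset.notMem_empty u)
    · have huv : u ≠ v := fun h => hvu (congrArg some h.symm)
      refine ⟨Nat.succ_ne_zero _, ?_⟩
      rw [addRoot_parent_some ((hanc hv).depth_ne_zero huv)]
      exact hparent hv huv
  · rintro (_ | v)
    exacts [Nat.zero_le _, hk v]

end Decomposition

/-! ### Brambles -/

section Helly

variable {N : Type v} {T : SimpleGraph N}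

/-- There are fewer edges than vertices, so two vertices choose the same edge. -/
theorem exists_apply_apply_eq_of_isTree [Finite N] (hT : T.IsTree) {f : N → N}
    (hf : ∀ t, T.Adj t (f t)) : ∃ t, f (f t) = t := by
  classical
  have := Fintype.ofFinite N
  have hcard := hT.card_edgeFinset
  obtain ⟨a, -, b, -, hab, heq⟩ := Finset.exists_ne_map_eq_of_card_lt_of_maps_to
    (s := Finset.univ) (t := T.edgeFinset) (f := fun t => s(t, f t))
    (by rw [Finset.card_univ]; omega) (fun t _ => by simpa using hf t)
  obtain ⟨rfl, -⟩ | ⟨hafb, hfab⟩ := Sym2.eq_iff.1 heq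
  · exact absurd rfl hab
  · exact ⟨a, by rw [hfab, ← hafb]⟩

theorem exists_adj_forall_reachable_deleteEdges (hT : T.Connected) {S : Set N}
    (hS : (T.induce S).Connected) {t : N} (ht : t ∉ S) :
    ∃ t', T.Adj t t' ∧ ∀ x ∈ S, (T.deleteEdges {s(t, t')}).Reachable t' x := by
  obtain ⟨⟨y, hy⟩⟩ := hS.nonempty
  obtain ⟨p, hp⟩ := hT.exists_isPath t y
  cases p with
  | nil => exact absurd hy ht
  | @cons _ t' _ hadj p =>
    refine ⟨t', hadj, fun x hx => ?_⟩
    have ht'y : (T.deleteEdges {s(t, t')}).Reachable t' y := by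
      refine reachable_deleteEdges_iff_exists_walk.2 ⟨p, fun h => ?_⟩
      exact ((Walk.cons_isPath_iff hadj p).1 hp).2 (p.fst_mem_support_of_mem_edges h)
    let f : T.induce S →g T.deleteEdges {s(t, t')} := ⟨Subtype.val, fun {a b} hab => by
      refine deleteEdges_adj.2 ⟨hab, fun h => ?_⟩
      obtain ⟨hat, -⟩ | ⟨-, hbt⟩ := Sym2.eq_iff.1 (Set.mem_singleton_iff.1 h)
      exacts [ht (hat ▸ a.2), ht (hbt ▸ b.2)]⟩
    exact ht'y.trans ((hS.preconnected ⟨y, hy⟩ ⟨x, hx⟩).map f)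

/-- The Helly property of subtrees. If no node lies in all sets, every node `t` has a neighbour
`f t` in the direction of a set avoiding `t`. Then `f (f t) = t` for some `t`, so there are two sets
on different sides of an edge. -/
theorem exists_forall_mem_of_isTree [Finite N] (hT : T.IsTree) {ι : Type w} {S : ι → Set N}
    (hconn : ∀ i, (T.induce (S i)).Connected) (hinter : ∀ i j, (S i ∩ S j).Nonempty) :
    ∃ t, ∀ i, t ∈ S i := by
  by_contra! hcon
  choose β hβ using hcon
  choose f hadj hside using fun t =>
    exists_adj_forall_reachable_deleteEdges hT.connected (hconn (β t)) (hβ t)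
  obtain ⟨t, ht⟩ := exists_apply_apply_eq_of_isTree hT hadj
  obtain ⟨x, hx, hx'⟩ := hinter (β t) (β (f t))
  have htx : (T.deleteEdges {s(t, f t)}).Reachable t x := by
    have := hside (f t) x hx'
    rwa [ht, Sym2.eq_swap] at this
  have hbridge := isAcyclic_iff_forall_adj_isBridge.1 hT.isAcyclic (hadj t)
  exact (isBridge_iff.1 hbridge) (htx.trans (hside t x hx).symm)

end Helly

section Bramble

variable {V : Type u} {G : SimpleGraph V} {ι : Type v} {B : ι → Set V}

/-- The nodes of a tree decomposition whose bags meet `S`. -/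
def TreeDecomposition.nodesMeeting (D : TreeDecomposition G) (S : Set V) : Set D.Node :=
  {t | ∃ v ∈ D.bag t, v ∈ S}

theorem TreeDecomposition.reachable_nodesMeeting (D : TreeDecomposition G) {S : Set V} {v w : S}
    (p : (G.induce S).Walk v w) {x y : D.Node} (hx : v.1 ∈ D.bag x) (hy : w.1 ∈ D.bag y) :
    (D.tree.induce (D.nodesMeeting S)).Reachable ⟨x, v, hx, v.2⟩ ⟨y, w, hy, w.2⟩ := by
  have hsame (v : S) {x y : D.Node} (hx : v.1 ∈ D.bag x) (hy : v.1 ∈ D.bag y) :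
      (D.tree.induce (D.nodesMeeting S)).Reachable ⟨x, v, hx, v.2⟩ ⟨y, v, hy, v.2⟩ :=
    have hle : {t | v.1 ∈ D.bag t} ≤ D.nodesMeeting S := fun t ht => ⟨v, ht, v.2⟩
    ((D.connected v).preconnected ⟨x, hx⟩ ⟨y, hy⟩).map (induceHomOfLE D.tree hle).toHom
  induction p generalizing x with
  | @nil v => exact hsame v hx hy
  | @cons v v' w hadj _ ih =>
    obtain ⟨z, hz, hz'⟩ := D.edge_mem hadj
    exact (hsame v hx hz).trans (ih hz' hy)

theorem TreeDecomposition.connected_nodesMeeting (D : TreeDecomposition G) {S : Set V}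
    (hS : (G.induce S).Connected) : (D.tree.induce (D.nodesMeeting S)).Connected := by
  obtain ⟨v⟩ := hS.nonempty
  obtain ⟨t, ht⟩ := D.vertex_mem v
  refine (connected_iff _).2 ⟨?_, ⟨⟨t, v, ht, v.2⟩⟩⟩
  rintro ⟨x, v, hx, hv⟩ ⟨y, w, hy, hw⟩
  obtain ⟨p⟩ := hS.preconnected ⟨v, hv⟩ ⟨w, hw⟩
  exact D.reachable_nodesMeeting p hx hy

/-- A bramble: a family of connected sets of vertices, any two of which intersect or are joined by
an edge. -/
structure IsBramble (G : SimpleGraph V) (B : ι → Set V) : Prop where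
  connected : ∀ i, (G.induce (B i)).Connected
  touch : ∀ i j, ∃ v ∈ B i, ∃ w ∈ B j, v = w ∨ G.Adj v w

theorem IsBramble.exists_bag_forall_mem (hB : IsBramble G B) (D : TreeDecomposition G) :
    ∃ t, ∀ i, ∃ v ∈ D.bag t, v ∈ B i := by
  have := D.finite_node
  refine exists_forall_mem_of_isTree D.isTree
    (fun i => D.connected_nodesMeeting (hB.connected i)) fun i j => ?_
  obtain ⟨v, hv, w, hw, rfl | hvw⟩ := hB.touch i j
  · obtain ⟨t, ht⟩ := D.vertex_mem v
    exact ⟨t, ⟨v, ht, hv⟩, ⟨v, ht, hw⟩⟩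
  · obtain ⟨t, htv, htw⟩ := D.edge_mem hvw
    exact ⟨t, ⟨v, htv, hv⟩, ⟨w, htw, hw⟩⟩

theorem IsBramble.le_treewidth [Finite V] (hB : IsBramble G B) {k : ℕ}
    (hk : ∀ X : Finset V, (∀ i, ∃ v ∈ X, v ∈ B i) → k < X.card) : k ≤ treewidth G := by
  obtain ⟨D, hD⟩ := exists_card_bag_le_treewidth_add_one G
  obtain ⟨t, ht⟩ := hB.exists_bag_forall_mem D
  exact Nat.lt_succ_iff.1 ((hk _ ht).trans_le (hD t))

end Bramble

/-! ### Subdivided claws -/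

section Claw

variable {ℓ ℓ' : Fin 3 → ℕ}

theorem subdividedClaw_adj_none {i : Fin 3} {j : Fin (ℓ i)} :
    (subdividedClaw ℓ).Adj none (some ⟨i, j⟩) ↔ (j : ℕ) = 0 := by
  simp [subdividedClaw, fromRel_adj]

theorem subdividedClaw_adj_some {i i' : Fin 3} {j : Fin (ℓ i)} {j' : Fin (ℓ i')} :
    (subdividedClaw ℓ).Adj (some ⟨i, j⟩) (some ⟨i', j'⟩) ↔
      i = i' ∧ ((j : ℕ) + 1 = j' ∨ (j' : ℕ) + 1 = j) := by
  constructor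
  · rintro ⟨-, ⟨rfl, h⟩ | ⟨rfl, h⟩⟩
    exacts [⟨rfl, Or.inl h.symm⟩, ⟨rfl, Or.inr h.symm⟩]
  · rintro ⟨rfl, h⟩
    refine ⟨fun heq => ?_, h.imp (fun h => ⟨rfl, h.symm⟩) fun h => ⟨rfl, h.symm⟩⟩
    obtain rfl : j = j' := by simpa using heq
    omega

/-- A subdivided claw as a tree rooted at its center. -/
def clawForest (ℓ : Fin 3 → ℕ) : RootedForest (Option (Σ i : Fin 3, Fin (ℓ i))) where
  parent
    | none => none
    | some ⟨_, ⟨0, _⟩⟩ => none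
    | some ⟨i, ⟨j + 1, hj⟩⟩ => some ⟨i, ⟨j, Nat.lt_of_succ_lt hj⟩⟩
  depth x := x.elim 0 fun a => a.2 + 1
  depth_parent := by
    rintro (_ | ⟨i, _ | j, hj⟩) h
    exacts [absurd rfl h, rfl, rfl]

theorem subdividedClaw_eq_graph_clawForest (ℓ : Fin 3 → ℕ) :
    subdividedClaw ℓ = (clawForest ℓ).graph := by
  refine le_antisymm ?_ (RootedForest.graph_le_iff.2 ?_)
  · have key (i : Fin 3) (j j' : Fin (ℓ i)) (h : (j' : ℕ) + 1 = j) :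
        (clawForest ℓ).graph.Adj (some ⟨i, j⟩) (some ⟨i, j'⟩) := by
      obtain ⟨_ | j, hj⟩ := j
      · exact absurd h (Nat.succ_ne_zero _)
      · obtain rfl : j' = ⟨j, Nat.lt_of_succ_lt hj⟩ := Fin.ext (Nat.succ_injective h)
        exact RootedForest.graph_adj_parent (Nat.succ_ne_zero _)
    have key_none (i : Fin 3) (j : Fin (ℓ i)) (h : (j : ℕ) = 0) :
        (clawForest ℓ).graph.Adj (some ⟨i, j⟩) none := by
      obtain ⟨j, hj⟩ := j
      obtain rfl : j = 0 := h
      exact RootedForest.graph_adj_parent (Nat.succ_ne_zero _)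
    rintro (_ | ⟨i, j⟩) (_ | ⟨i', j'⟩) h
    · exact absurd h (SimpleGraph.irrefl _)
    · exact (key_none i' j' (subdividedClaw_adj_none.1 h)).symm
    · exact key_none i j (subdividedClaw_adj_none.1 h.symm)
    · obtain ⟨rfl, h | h⟩ := subdividedClaw_adj_some.1 h
      exacts [(key i j' j h).symm, key i j j' h]
  · rintro (_ | ⟨i, _ | j, hj⟩) h
    · exact absurd rfl h
    · exact SimpleGraph.Adj.symm (u := none) (subdividedClaw_adj_none.2 rfl)
    · exact subdividedClaw_adj_some.2 ⟨rfl, Or.inr rfl⟩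

theorem subdividedClaw_isAcyclic (ℓ : Fin 3 → ℕ) : (subdividedClaw ℓ).IsAcyclic :=
  subdividedClaw_eq_graph_clawForest ℓ ▸ (clawForest ℓ).graph_isAcyclic

theorem subdividedClaw_connected (ℓ : Fin 3 → ℕ) : (subdividedClaw ℓ).Connected := by
  rw [subdividedClaw_eq_graph_clawForest]
  refine RootedForest.graph_connected (t := none) fun x hx => ?_
  obtain ⟨s, rfl⟩ := Option.ne_none_iff_exists'.1 hx
  exact Nat.succ_ne_zero _

theorem subdividedClaw_isContained {V : Type v} {G : SimpleGraph V}
    {f : Option (Σ i : Fin 3, Fin (ℓ i)) → V} (hf : Function.Injective f)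
    (hnone : ∀ i (hi : 0 < ℓ i), G.Adj (f (some ⟨i, 0, hi⟩)) (f none))
    (hsome : ∀ i j (hj : j + 1 < ℓ i),
      G.Adj (f (some ⟨i, j + 1, hj⟩)) (f (some ⟨i, j, Nat.lt_of_succ_lt hj⟩))) :
    subdividedClaw ℓ ⊑ G := by
  have hle : (clawForest ℓ).graph ≤ G.comap f := by
    refine RootedForest.graph_le_iff.2 ?_
    rintro (_ | ⟨i, _ | j, hj⟩) h
    exacts [absurd rfl h, hnone i hj, hsome i j hj]
  rw [subdividedClaw_eq_graph_clawForest]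
  exact ⟨⟨⟨f, fun h => hle h⟩, hf⟩⟩

/-- The embedding of a subdivided claw into a subdivided claw with longer legs. -/
def clawEmbedding (h : ℓ ≤ ℓ') : subdividedClaw ℓ ↪g subdividedClaw ℓ' where
  toFun := Option.map (Sigma.map id fun i => Fin.castLE (h i))
  inj' := Option.map_injective
    (Function.injective_id.sigma_map fun i => Fin.castLE_injective (h i))
  map_rel_iff' := by
    rintro (_ | ⟨i, j⟩) (_ | ⟨i', j'⟩) <;>
      simp [Sigma.map, adj_comm _ _ none, subdividedClaw_adj_none, subdividedClaw_adj_some]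

theorem some_mem_range_clawEmbedding (h : ℓ ≤ ℓ') {i : Fin 3} {j : Fin (ℓ' i)} :
    some ⟨i, j⟩ ∈ Set.range (clawEmbedding h) ↔ (j : ℕ) < ℓ i := by
  constructor
  · rintro ⟨_ | ⟨i', j'⟩, h⟩
    · cases h
    · cases h
      exact j'.2
  · exact fun hj => ⟨some ⟨i, j, hj⟩, rfl⟩

theorem pathGraph_isContained_subdividedClaw {n : ℕ} {i : Fin 3} (h : n ≤ ℓ i) :
    pathGraph n ⊑ subdividedClaw ℓ := by
  refine ⟨⟨⟨fun j => some ⟨i, Fin.castLE h j⟩, fun {a b} hab => ?_⟩, fun a b hab => ?_⟩⟩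
  · simpa [subdividedClaw_adj_some] using pathGraph_adj.1 hab
  · have : Fin.castLE h a = Fin.castLE h b := by simpa using hab
    exact Fin.castLE_injective h this

theorem isContained_subdividedClaw_of_card_le {V : Type u} [Finite V] {G : SimpleGraph V} {l : ℕ}
    (hl : Nat.card V ≤ l) (h : IsPathGraph G ∨ IsSubdividedClaw G) :
    G ⊑ subdividedClaw fun _ => l := by
  obtain ⟨n, -, ⟨e⟩⟩ | ⟨ℓ, -, ⟨e⟩⟩ := h
  · have hn : n ≤ l := by simpa [Nat.card_congr e.toEquiv] using hl
    exact e.isContained.trans (pathGraph_isContained_subdividedClaw (i := 0) hn)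
  · refine e.isContained.trans (clawEmbedding fun i => ?_).isContained
    have hleg : Function.Injective fun j : Fin (ℓ i) => e.symm (some ⟨i, j⟩) :=
      e.symm.injective.comp ((Option.some_injective _).comp sigma_mk_injective)
    simpa using (Nat.card_le_card_of_injective _ hleg).trans hl

end Claw

/-! ### Excluding a subdivided claw -/

/-- The centre is `a m`, and the legs are an initial segment starting at `a 0` and the two segments
on either side of `a m`. -/
theorem subdividedClaw_isContained_of_chord {V : Type v} {G : SimpleGraph V} {a : ℕ → V}
    {l m n : ℕ} (hinj : Set.InjOn a (Set.Iic n)) (hadj : ∀ k < n, G.Adj (a k) (a (k + 1)))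
    (hchord : G.Adj (a 0) (a m)) (hlm : 2 * l ≤ m) (hmn : m + l ≤ n) :
    (subdividedClaw fun _ => l) ⊑ G := by
  let index (x : Option (Σ _ : Fin 3, Fin l)) : ℕ :=
    x.elim m fun s => if s.1 = 0 then m + 1 + s.2 else if s.1 = 1 then s.2 else m - 1 - s.2
  have hindex (x) : index x ≤ n := by
    rcases x with _ | ⟨i, j⟩
    · exact (Nat.le_add_right m l).trans hmn
    · simp only [index, Option.elim]
      split_ifs <;> omega
  have hindex_inj : Function.Injective index := by
    rintro (_ | ⟨i, j⟩) (_ | ⟨i', j'⟩) h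
    · rfl
    · simp only [index, Option.elim] at h
      split_ifs at h <;> omega
    · simp only [index, Option.elim] at h
      split_ifs at h <;> omega
    · simp only [index, Option.elim] at h
      obtain rfl : i = i' := by split_ifs at h <;> omega
      obtain rfl : j = j' := by split_ifs at h <;> omega
      rfl
  refine subdividedClaw_isContained (f := fun x => a (index x))
    (fun x y h => hindex_inj (hinj (hindex x) (hindex y) h)) (fun i hl => ?_) fun i j hj => ?_
  · fin_cases i
    · exact (hadj m (by omega)).symm
    · exact hchord
    · simpa [index, show m - 1 + 1 = m by omega] using hadj (m - 1) (by omega)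
  · fin_cases i
    · exact (hadj (m + 1 + j) (by omega)).symm
    · exact (hadj j (by omega)).symm
    · simpa [index, show m - 1 - (j + 1) + 1 = m - 1 - j by omega] using
        hadj (m - 1 - (j + 1)) (by omega)

theorem RootedForest.IsNormal.subdividedClaw_isContained {V : Type v} {G : SimpleGraph V}
    {F : RootedForest V} (hF : F.IsNormal G) {u v : V} (huv : G.Adj u v) (hanc : F.IsAncestor u v)
    {l : ℕ} (hu : l ≤ F.depth u) (hv : F.depth u + 2 * l ≤ F.depth v) :
    (subdividedClaw fun _ => l) ⊑ G := by
  refine subdividedClaw_isContained_of_chord (a := fun k => F.parent^[k] v) (n := F.depth v)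
    (m := F.depth v - F.depth u) injOn_iterate (fun k hk => hF.graph_le (graph_adj_iterate hk)) ?_
    (by omega) (by omega)
  simpa only [hanc.iterate_eq, Function.iterate_zero_apply] using huv.symm

/-- An edge joining `v` to an ancestor outside the bag of `v` would be the chord of a claw. -/
theorem treewidth_le_of_subdividedClaw_free {V : Type u} [Finite V] {G : SimpleGraph V} {l : ℕ}
    (hG : (subdividedClaw fun _ => l).Free G) : treewidth G ≤ 3 * l := by
  classical
  have := Fintype.ofFinite V
  obtain ⟨F, hF⟩ := RootedForest.exists_isNormal G
  let bag (v : V) : Finset V :=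
    {u | F.IsAncestor u v ∧ (F.depth u < l ∨ F.depth v ≤ F.depth u + 2 * l)}
  have hbag (u v : V) : u ∈ bag v ↔
      F.IsAncestor u v ∧ (F.depth u < l ∨ F.depth v ≤ F.depth u + 2 * l) := by simp [bag]
  refine hF.treewidth_le bag (fun v => (hbag v v).2 ⟨.refl v, by omega⟩)
    (fun u v h => ((hbag u v).1 h).1) (fun u v h huv => ?_) (fun u v huv hanc => ?_) fun v => ?_
  · obtain ⟨hanc, hdepth⟩ := (hbag u v).1 h
    have := F.depth_parent (hanc.depth_ne_zero huv)
    exact (hbag u _).2 ⟨hanc.parent huv, by omega⟩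
  · refine (hbag u v).2 ⟨hanc, ?_⟩
    by_contra! hfar
    exact hG (hF.subdividedClaw_isContained huv hanc hfar.1 hfar.2.le)
  · have hmaps : ∀ u ∈ bag v,
        F.depth u ∈ Finset.range l ∪ Finset.Icc (F.depth v - 2 * l) (F.depth v) := by
      intro u hu
      obtain ⟨hanc, hdepth⟩ := (hbag u v).1 hu
      have := hanc.depth_le
      simp only [Finset.mem_union, Finset.mem_range, Finset.mem_Icc]
      omega
    have hinj : Set.InjOn F.depth (bag v : Set V) := fun a ha b hb hab =>
      ((hbag a v).1 ha).1.eq_of_depth_eq ((hbag b v).1 hb).1 hab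
    refine (Finset.card_le_card_of_injOn F.depth hmaps hinj).trans
      ((Finset.card_union_le _ _).trans ?_)
    rw [Finset.card_range, Nat.card_Icc]
    omega

/-! ### Connected subgraphs of subdivided claws -/

section Classification

variable {ℓ : Fin 3 → ℕ} {V : Type u} {C : SimpleGraph V}

/-- The map from a subdivided claw to the line that sends the center to `0`, the leg `i₀ + 1` to the
positive integers and both other legs to the negative integers. -/
def clawFold (ℓ : Fin 3 → ℕ) (i₀ : Fin 3) : subdividedClaw ℓ →g hasse ℤ where
  toFun x := x.elim 0 fun s => if s.1 = i₀ + 1 then (s.2 : ℤ) + 1 else -((s.2 : ℤ) + 1)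
  map_rel' := by
    rintro (_ | ⟨i, j⟩) (_ | ⟨i', j'⟩) h
    · exact absurd h (SimpleGraph.irrefl _)
    · have := subdividedClaw_adj_none.1 h
      simp only [hasse_adj, Order.covBy_iff_add_one_eq, Option.elim]
      split_ifs <;> omega
    · have := subdividedClaw_adj_none.1 h.symm
      simp only [hasse_adj, Order.covBy_iff_add_one_eq, Option.elim]
      split_ifs <;> omega
    · obtain ⟨rfl, h⟩ := subdividedClaw_adj_some.1 h
      simp only [hasse_adj, Order.covBy_iff_add_one_eq, Option.elim]
      split_ifs <;> omega

theorem clawFold_none (i₀ : Fin 3) : clawFold ℓ i₀ none = 0 :=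
  rfl

theorem clawFold_some (i₀ i : Fin 3) (j : Fin (ℓ i)) :
    clawFold ℓ i₀ (some ⟨i, j⟩) = if i = i₀ + 1 then (j : ℤ) + 1 else -((j : ℤ) + 1) :=
  rfl

theorem injOn_clawFold (i₀ : Fin 3) :
    Set.InjOn (clawFold ℓ i₀) {x | ∀ j, x ≠ some ⟨i₀, j⟩} := by
  rintro (_ | ⟨i, j⟩) hx (_ | ⟨i', j'⟩) hx' h
  · rfl
  · rw [clawFold_none, clawFold_some] at h
    split_ifs at h <;> omega
  · rw [clawFold_none, clawFold_some] at h
    split_ifs at h <;> omega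
  · have hi : i ≠ i₀ := by rintro rfl; exact hx j rfl
    have hi' : i' ≠ i₀ := by rintro rfl; exact hx' j' rfl
    rw [clawFold_some, clawFold_some] at h
    obtain rfl : i = i' := by split_ifs at h <;> omega
    obtain rfl : j = j' := by split_ifs at h <;> omega
    rfl

theorem isPathGraph_of_forall_ne [Finite V] (hC : C.Connected) (f : C.Copy (subdividedClaw ℓ))
    {i₀ : Fin 3} (hi₀ : ∀ x j, f x ≠ some ⟨i₀, j⟩) : IsPathGraph C :=
  isPathGraph_of_isContained_hasse hC ⟨⟨(clawFold ℓ i₀).comp f.toHom, fun x y hxy =>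
    f.injective (injOn_clawFold i₀ (hi₀ x) (hi₀ y) hxy)⟩⟩

theorem RootedForest.parent_mem_range {W : Type w} {F : RootedForest W} (hC : C.Preconnected)
    (f : C →g F.graph) {x : W} (hx : x ∈ Set.range f) {y : W} (hy : y ∈ Set.range f)
    (hxy : ¬ F.IsAncestor x y) : F.parent x ∈ Set.range f := by
  obtain ⟨a, rfl⟩ := hx
  obtain ⟨b, rfl⟩ := hy
  obtain ⟨z, hz, w, hw, hzw⟩ :=
    exists_boundary_adj (hC a b) (S := {z | F.IsAncestor (f a) (f z)}) (.refl _) hxy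
  exact ⟨w, (eq_and_parent_eq_of_graph_adj (f.map_adj hzw) hz hw).2.symm⟩

theorem leg_eq_of_isAncestor_clawForest {i i' : Fin 3} {j : Fin (ℓ i)} {j' : Fin (ℓ i')}
    (h : (clawForest ℓ).IsAncestor (some ⟨i, j⟩) (some ⟨i', j'⟩)) : i = i' := by
  obtain ⟨j', hj'⟩ := j'
  induction j' with
  | zero =>
    obtain ⟨_ | _ | k, hk, h⟩ := h
    · cases h; rfl
    · cases h
    · exact absurd hk (by simp [clawForest])
  | succ j' ih =>
    by_cases heq : (some ⟨i, j⟩ : Option (Σ i, Fin (ℓ i))) = some ⟨i', j' + 1, hj'⟩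
    · cases heq; rfl
    · exact ih _ (h.parent heq)

theorem exists_forall_mem_iff_lt {J : Set ℕ} (hJ : ∀ j, j + 1 ∈ J → j ∈ J) {b : ℕ} (hb : b ∉ J) :
    ∃ n, ∀ j, j ∈ J ↔ j < n := by
  classical
  have hex : ∃ n, n ∉ J := ⟨b, hb⟩
  refine ⟨Nat.find hex, fun j => ⟨fun hj => ?_, fun hj => not_not.1 (Nat.find_min hex hj)⟩⟩
  by_contra! hle
  exact Nat.find_spec hex (Nat.decreasingInduction (fun k _ hk => hJ k hk) hj hle)

theorem isSubdividedClaw_of_forall_exists_eq (hC : C.Connected) (f : C.Copy (subdividedClaw ℓ))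
    (hlegs : ∀ i, ∃ x j, f x = some ⟨i, j⟩) : IsSubdividedClaw C := by
  let F : C ↪g subdividedClaw ℓ := ⟨⟨f, f.injective⟩,
    adj_copy_iff_of_isAcyclic hC.preconnected (subdividedClaw_isAcyclic ℓ) f⟩
  have hparent (i) (j : Fin (ℓ i)) (hx : some ⟨i, j⟩ ∈ Set.range F) :
      (clawForest ℓ).parent (some ⟨i, j⟩) ∈ Set.range F := by
    obtain ⟨y, j', hy⟩ := hlegs (i + 1)
    have hle : C ≤ (clawForest ℓ).graph.comap f := fun a b hab =>
      subdividedClaw_eq_graph_clawForest ℓ ▸ f.toHom.map_adj hab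
    exact RootedForest.parent_mem_range hC.preconnected ⟨f, fun h => hle h⟩ hx ⟨y, hy⟩ fun h => by
      simpa using leg_eq_of_isAncestor_clawForest h
  have hleg (i : Fin 3) : ∃ n, ∀ j, (∃ hj : j < ℓ i, some ⟨i, j, hj⟩ ∈ Set.range F) ↔ j < n :=
    exists_forall_mem_iff_lt (J := {j | ∃ hj : j < ℓ i, some ⟨i, j, hj⟩ ∈ Set.range F})
      (fun j ⟨hj, h⟩ => ⟨Nat.lt_of_succ_lt hj, hparent i ⟨j + 1, hj⟩ h⟩)
      fun ⟨hb, _⟩ => lt_irrefl (ℓ i) hb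
  choose ℓ' hℓ' using hleg
  have hle : ℓ' ≤ ℓ := fun i => not_lt.1 fun h => lt_irrefl _ ((hℓ' i _).2 h).1
  have hpos (i : Fin 3) : 0 < ℓ' i := by
    obtain ⟨x, j, hx⟩ := hlegs i
    exact (Nat.zero_le j).trans_lt ((hℓ' i j).1 ⟨j.2, x, hx⟩)
  have hnone : none ∈ Set.range F := hparent 0 _ ((hℓ' 0 0).2 (hpos 0)).2
  have hrange : Set.range F = Set.range (clawEmbedding hle) := by
    ext (_ | ⟨i, j⟩)
    · exact iff_of_true hnone ⟨none, rfl⟩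
    · rw [some_mem_range_clawEmbedding, ← hℓ' i j]
      exact ⟨fun h => ⟨j.2, h⟩, fun ⟨_, h⟩ => h⟩
  exact ⟨ℓ', hpos, nonempty_iso_of_range_eq F (clawEmbedding hle) hrange⟩

theorem isPathGraph_or_isSubdividedClaw [Finite V] (hC : C.Connected)
    (h : C ⊑ subdividedClaw ℓ) : IsPathGraph C ∨ IsSubdividedClaw C := by
  obtain ⟨f⟩ := h
  by_cases hlegs : ∀ i, ∃ x j, f x = some ⟨i, j⟩
  · exact Or.inr (isSubdividedClaw_of_forall_exists_eq hC f hlegs)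
  · push Not at hlegs
    obtain ⟨i₀, hi₀⟩ := hlegs
    exact Or.inl (isPathGraph_of_forall_ne hC f hi₀)

end Classification

/-! ### Packing copies of a graph -/

theorem exists_disjoint_copies_or_free_induce_compl {A : Type v} [Finite A] (S : SimpleGraph A)
    {V : Type w} (G : SimpleGraph V) (m : ℕ) :
    (∃ f : Fin m → S.Copy G, Pairwise fun i j => ∀ a b, f i a ≠ f j b) ∨
      ∃ X : Finset V, X.card ≤ m * Nat.card A ∧ S.Free (G.induce (X : Set V)ᶜ) := by
  classical
  have := Fintype.ofFinite A
  induction m with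
  | zero => exact Or.inl ⟨Fin.elim0, fun i => i.elim0⟩
  | succ m ih =>
    obtain ⟨f, hf⟩ | ⟨X, hX, hfree⟩ := ih
    swap
    · exact Or.inr ⟨X, hX.trans (Nat.mul_le_mul_right _ m.le_succ), hfree⟩
    let X : Finset V := Finset.univ.biUnion fun i => Finset.univ.image (f i)
    have hX : X.card ≤ m * Nat.card A := by
      simpa using Finset.card_biUnion_le_card_mul Finset.univ (fun i => Finset.univ.image (f i))
        (Nat.card A) fun i _ => by
          simpa using Finset.card_image_le (s := Finset.univ) (f := f i)
    by_cases hfree : S.Free (G.induce (X : Set V)ᶜ)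
    · exact Or.inr ⟨X, hX.trans (Nat.mul_le_mul_right _ m.le_succ), hfree⟩
    obtain ⟨g⟩ := not_not.1 hfree
    have hg (a i b) : (g a : V) ≠ f i b := fun hab => (g a).2 <| Finset.mem_biUnion.2
      ⟨i, Finset.mem_univ _, Finset.mem_image.2 ⟨b, Finset.mem_univ _, hab.symm⟩⟩
    refine Or.inl ⟨Fin.cons ((Copy.induce G _).comp g) f, fun i j hij a b => ?_⟩
    cases i using Fin.cases <;> cases j using Fin.cases
    · exact absurd rfl hij
    · exact hg a _ b
    · exact (hg b _ a).symm
    · exact hf (ne_of_apply_ne Fin.succ hij) a b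

theorem isContained_of_disjoint_copies {W : Type v} {H : SimpleGraph W} {V : Type w}
    {G : SimpleGraph V} (f : ∀ C : H.ConnectedComponent, C.toSimpleGraph.Copy G)
    (hf : Pairwise fun C D => ∀ a b, f C a ≠ f D b) : H ⊑ G := by
  refine ⟨⟨homOfConnectedComponents H fun C => (f C).toHom, fun x y hxy => ?_⟩⟩
  by_contra hne
  have key (C D : H.ConnectedComponent) (hx : x ∈ C) (hy : y ∈ D) :
      f C ⟨x, hx⟩ ≠ f D ⟨y, hy⟩ := by
    obtain rfl | hCD := eq_or_ne C D
    · exact fun h => hne (congrArg Subtype.val ((f C).injective h))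
    · exact hf hCD _ _
  exact key _ _ rfl rfl hxy

theorem hasBoundedTreewidth_of_memS {W : Type u} [Finite W] {H : SimpleGraph W} (hH : MemS H) :
    HasBoundedTreewidth (subgraphFree H) := by
  let l := Nat.card W
  let S := subdividedClaw fun _ => l
  let m := Nat.card H.ConnectedComponent
  let k := Nat.card (Option (Σ _ : Fin 3, Fin l))
  have hcomp (C : H.ConnectedComponent) : C.toSimpleGraph ⊑ S :=
    isContained_subdividedClaw_of_card_le (Finite.card_subtype_le _) (hH C)
  refine ⟨3 * l + m * k, fun V _ G hG => ?_⟩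
  obtain ⟨f, hf⟩ | ⟨X, hX, hfree⟩ := exists_disjoint_copies_or_free_induce_compl S G m
  · refine absurd (isContained_of_disjoint_copies
      (fun C => (f (Finite.equivFin _ C)).comp (hcomp C).some) fun C D hCD a b => ?_) hG
    exact hf ((Finite.equivFin _).injective.ne hCD) _ _
  · exact (treewidth_le_treewidth_induce_compl_add_card X).trans
      (Nat.add_le_add (treewidth_le_of_subdividedClaw_free hfree) hX)

/-! ### Claws linked at their tips -/

/-- Walks from `f x` of length less than `Nat.card V` lift to walks from `s` in `T`, because their
lifts do not leave the part of `T` where `d < n`. -/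
theorem isContained_of_forall_lift {A : Type*} {T : SimpleGraph A} {X : Type*} {G : SimpleGraph X}
    {V : Type*} [Finite V] {C : SimpleGraph V} {π : A → X} (hπ : Function.Injective π) {d : A → ℕ}
    {n : ℕ} (hd : ∀ ⦃s t⦄, T.Adj s t → d t ≤ d s + 1)
    (hlift : ∀ ⦃s y⦄, d s < n → G.Adj (π s) y → ∃ t, T.Adj s t ∧ π t = y) (hC : C.Connected)
    (f : C.Copy G) {x : V} {s : A} (hs : π s = f x) (hn : d s + Nat.card V ≤ n) : C ⊑ T := by
  have hwalk {x y : V} (p : C.Walk x y) : ∀ s, π s = f x → d s + p.length < n →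
      ∃ t, π t = f y ∧ d t < n := by
    induction p with
    | nil => exact fun s hs hn => ⟨s, hs, hn⟩
    | cons h p ih =>
      intro s hs hn
      rw [Walk.length_cons] at hn
      obtain ⟨t, hst, ht⟩ := hlift (by omega) (hs ▸ f.toHom.map_adj h)
      have := hd hst
      exact ih t ht (by omega)
  have hall (y : V) : ∃ t, π t = f y ∧ d t < n := by
    have := Fintype.ofFinite V
    obtain ⟨p, hp⟩ := hC.exists_isPath x y
    have := hp.length_lt
    exact hwalk p s hs (by rw [Nat.card_eq_fintype_card] at hn; omega)
  choose g hg hgn using hall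
  refine ⟨⟨⟨g, fun {y z} hyz => ?_⟩, fun y z hyz => f.injective ?_⟩⟩
  · obtain ⟨t, ht, htz⟩ := hlift (hgn y) (hg y ▸ f.toHom.map_adj hyz)
    exact hπ (htz.trans (hg z).symm) ▸ ht
  · exact (hg y).symm.trans ((congrArg π hyz).trans (hg z))

section LinkedClaws

variable {B : Type v} {σ : B × Fin 3 → B × Fin 3} {L : ℕ}

/-- The tip of the leg `h.2` of the claw indexed by `h.1`. -/
def tip (L : ℕ) (h : B × Fin 3) : B × Option (Σ _ : Fin 3, Fin (L + 1)) :=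
  (h.1, some ⟨h.2, Fin.last L⟩)

/-- A disjoint union of claws with legs of length `L + 1`, indexed by `B`, whose tips are joined in
pairs as prescribed by `σ`. -/
def linkedClaws (σ : B × Fin 3 → B × Fin 3) (L : ℕ) :
    SimpleGraph (B × Option (Σ _ : Fin 3, Fin (L + 1))) :=
  ((⊥ : SimpleGraph B) □ subdividedClaw fun _ => L + 1) ⊔ ⨆ h, edge (tip L h) (tip L (σ h))

/-- The graph obtained from `linkedClaws σ L` by contracting each claw. -/
def linkGraph (σ : B × Fin 3 → B × Fin 3) : SimpleGraph B :=
  ⨆ h, edge h.1 (σ h).1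

theorem linkedClaws_adj_mk {b : B} {s t : Option (Σ _ : Fin 3, Fin (L + 1))}
    (h : (subdividedClaw fun _ => L + 1).Adj s t) : (linkedClaws σ L).Adj (b, s) (b, t) :=
  Or.inl (boxProd_adj_right.2 h)

theorem linkedClaws_adj_tip (hne : ∀ h, (σ h).1 ≠ h.1) (h : B × Fin 3) :
    (linkedClaws σ L).Adj (tip L h) (tip L (σ h)) :=
  Or.inr (iSup_adj.2 ⟨h, (edge_adj ..).2 ⟨Or.inl ⟨rfl, rfl⟩, fun heq =>
    hne h (congrArg Prod.fst heq).symm⟩⟩)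

theorem eq_or_eq_tip_of_linkedClaws_adj (hσ : Function.Involutive σ)
    {x y : B × Option (Σ _ : Fin 3, Fin (L + 1))} (hxy : (linkedClaws σ L).Adj x y) :
    (x.1 = y.1 ∧ (subdividedClaw fun _ => L + 1).Adj x.2 y.2) ∨
      ∃ h, x = tip L h ∧ y = tip L (σ h) := by
  obtain hxy | hxy := hxy
  · exact Or.inl (by simpa [boxProd_adj, and_comm] using hxy)
  · obtain ⟨h, hxy⟩ := iSup_adj.1 hxy
    obtain ⟨⟨rfl, rfl⟩ | ⟨rfl, rfl⟩, -⟩ := (edge_adj ..).1 hxy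
    · exact Or.inr ⟨h, rfl, rfl⟩
    · exact Or.inr ⟨σ h, rfl, by rw [hσ]⟩

theorem exists_eq_of_linkGraph_adj (hσ : Function.Involutive σ) {b b' : B}
    (hbb' : (linkGraph σ).Adj b b') : ∃ h, h.1 = b ∧ (σ h).1 = b' := by
  obtain ⟨h, hbb'⟩ := iSup_adj.1 hbb'
  obtain ⟨⟨rfl, rfl⟩ | ⟨rfl, rfl⟩, -⟩ := (edge_adj ..).1 hbb'
  · exact ⟨h, rfl, rfl⟩
  · exact ⟨σ h, rfl, by rw [hσ]⟩

theorem linkedClaws_induce_connected (hσ : Function.Involutive σ) (hne : ∀ h, (σ h).1 ≠ h.1)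
    {Q : Set B} (hQ : ((linkGraph σ).induce Q).Connected) :
    ((linkedClaws σ L).induce {x | x.1 ∈ Q}).Connected := by
  let G := (linkedClaws σ L).induce {x | x.1 ∈ Q}
  let claw (b : Q) : (subdividedClaw fun _ => L + 1) →g G :=
    ⟨fun s => ⟨(b, s), b.2⟩, fun h => linkedClaws_adj_mk h⟩
  have hclaw (b : Q) (s t) : G.Reachable (claw b s) (claw b t) :=
    (subdividedClaw_connected _ s t).map (claw b)
  have hlink (b b' : Q) (h : (linkGraph σ).Adj b b') :
      G.Reachable (claw b none) (claw b' none) := by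
    obtain ⟨h, hb, hb'⟩ := exists_eq_of_linkGraph_adj hσ h
    have htips : G.Adj (claw b (tip L h).2) (claw b' (tip L (σ h)).2) := by
      have := linkedClaws_adj_tip (L := L) hne h
      rwa [tip, tip, hb, hb'] at this
    exact (hclaw b _ _).trans (htips.reachable.trans (hclaw b' _ _))
  have hcenter (b b' : Q) (p : ((linkGraph σ).induce Q).Walk b b') :
      G.Reachable (claw b none) (claw b' none) := by
    induction p with
    | nil => exact Reachable.refl _
    | cons h _ ih => exact (hlink _ _ h).trans ih
  have hpre : G.Preconnected := by
    rintro ⟨⟨b, s⟩, hb⟩ ⟨⟨b', s'⟩, hb'⟩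
    obtain ⟨p⟩ := hQ.preconnected ⟨b, hb⟩ ⟨b', hb'⟩
    exact (hclaw ⟨b, hb⟩ s none).trans ((hcenter _ _ p).trans (hclaw ⟨b', hb'⟩ none s'))
  obtain ⟨b⟩ := hQ.nonempty
  exact { preconnected := hpre, nonempty := ⟨claw b none⟩ }

/-- The claw indexed by `b` in `linkedClaws σ L`, with each of its legs extended by the leg linked
to it, traversed from the tip towards the center. -/
def unfoldClaw (σ : B × Fin 3 → B × Fin 3) (L : ℕ) (b : B) :
    Option (Σ _ : Fin 3, Fin ((L + 1) + (L + 1))) → B × Option (Σ _ : Fin 3, Fin (L + 1))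
  | none => (b, none)
  | some ⟨i, j⟩ => Fin.addCases (fun j => (b, some ⟨i, j⟩))
      (fun j => ((σ (b, i)).1, some ⟨(σ (b, i)).2, j.rev⟩)) j

theorem unfoldClaw_none (b : B) : unfoldClaw σ L b none = (b, none) :=
  rfl

theorem unfoldClaw_castAdd (b : B) (i : Fin 3) (j : Fin (L + 1)) :
    unfoldClaw σ L b (some ⟨i, Fin.castAdd _ j⟩) = (b, some ⟨i, j⟩) := by
  rw [unfoldClaw, Fin.addCases_left]

theorem unfoldClaw_natAdd_rev (b : B) (i : Fin 3) (j : Fin (L + 1)) :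
    unfoldClaw σ L b (some ⟨i, Fin.natAdd _ j.rev⟩) = ((σ (b, i)).1, some ⟨(σ (b, i)).2, j⟩) := by
  rw [unfoldClaw, Fin.addCases_right, Fin.rev_rev]

theorem unfoldClaw_clawEmbedding (b : B) (s : Option (Σ _ : Fin 3, Fin (L + 1))) :
    unfoldClaw σ L b (clawEmbedding (fun _ => Nat.le_add_right _ _) s) = (b, s) := by
  obtain _ | ⟨i, j⟩ := s
  · rfl
  · exact unfoldClaw_castAdd b i j

theorem eq_none_or_castAdd_or_natAdd_rev {m n : ℕ} (s : Option (Σ _ : Fin 3, Fin (m + n))) :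
    s = none ∨ (∃ i j, s = some ⟨i, Fin.castAdd n j⟩) ∨
      ∃ i j, s = some ⟨i, Fin.natAdd m (.rev j)⟩ := by
  obtain _ | ⟨i, j⟩ := s
  · exact Or.inl rfl
  · cases j using Fin.addCases with
    | left j => exact Or.inr (Or.inl ⟨i, j, rfl⟩)
    | right j => exact Or.inr (Or.inr ⟨i, j.rev, by rw [Fin.rev_rev]⟩)

theorem unfoldClaw_injective (hσ : Function.Injective σ) (hne : ∀ h, (σ h).1 ≠ h.1) (b : B) :
    Function.Injective (unfoldClaw σ L b) := by
  intro s t h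
  obtain rfl | ⟨i, j, rfl⟩ | ⟨i, j, rfl⟩ := eq_none_or_castAdd_or_natAdd_rev s <;>
    obtain rfl | ⟨i', j', rfl⟩ | ⟨i', j', rfl⟩ := eq_none_or_castAdd_or_natAdd_rev t <;>
    simp only [unfoldClaw_none, unfoldClaw_castAdd, unfoldClaw_natAdd_rev, Prod.mk.injEq,
      Option.some.injEq, Sigma.mk.injEq, heq_eq_eq, reduceCtorEq, and_false] at h
  · rfl
  · obtain ⟨-, rfl, rfl⟩ := h
    rfl
  · exact absurd h.1.symm (hne _)
  · exact absurd h.1 (hne _)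
  · obtain ⟨h₁, h₂, rfl⟩ := h
    cases hσ (Prod.ext h₁ h₂)
    rfl

theorem exists_unfoldClaw_eq_of_adj (hσ : Function.Involutive σ) {b : B}
    {s : Option (Σ _ : Fin 3, Fin ((L + 1) + (L + 1)))}
    {y : B × Option (Σ _ : Fin 3, Fin (L + 1))}
    (hs : (clawForest fun _ => (L + 1) + (L + 1)).depth s < (L + 1) + (L + 1))
    (hy : (linkedClaws σ L).Adj (unfoldClaw σ L b s) y) :
    ∃ t, (subdividedClaw fun _ => (L + 1) + (L + 1)).Adj s t ∧ unfoldClaw σ L b t = y := by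
  obtain ⟨b', s'⟩ := y
  have hclaw {s} (h : (subdividedClaw fun _ => L + 1).Adj s s') :
      ∃ t, (subdividedClaw fun _ => (L + 1) + (L + 1)).Adj
        (clawEmbedding (fun _ => Nat.le_add_right _ _) s) t ∧ unfoldClaw σ L b t = (b, s') :=
    ⟨_, (clawEmbedding _).map_adj_iff.2 h, unfoldClaw_clawEmbedding b s'⟩
  obtain rfl | ⟨i, j, rfl⟩ | ⟨i, j, rfl⟩ := eq_none_or_castAdd_or_natAdd_rev s <;>
    simp only [unfoldClaw_none, unfoldClaw_castAdd, unfoldClaw_natAdd_rev] at hy <;>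
    obtain ⟨rfl, h⟩ | ⟨⟨b₀, i₀⟩, hx, hx'⟩ := eq_or_eq_tip_of_linkedClaws_adj hσ hy
  · exact hclaw h
  · cases hx
  · exact hclaw h
  · cases hx
    refine ⟨some ⟨i₀, Fin.natAdd _ (Fin.rev (Fin.last L))⟩,
      subdividedClaw_adj_some.2 ⟨rfl, Or.inl ?_⟩, hx' ▸ unfoldClaw_natAdd_rev ..⟩
    simp
  · obtain _ | ⟨i', j'⟩ := s'
    · have hj := subdividedClaw_adj_none.1 h.symm
      simp only [clawForest, Option.elim_some, Fin.val_natAdd, Fin.val_rev, hj] at hs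
      omega
    · obtain ⟨rfl, h⟩ := subdividedClaw_adj_some.1 h
      refine ⟨some ⟨i, Fin.natAdd _ j'.rev⟩, subdividedClaw_adj_some.2 ⟨rfl, ?_⟩,
        unfoldClaw_natAdd_rev ..⟩
      simp only [Fin.val_natAdd, Fin.val_rev]
      omega
  · obtain ⟨h, rfl⟩ : σ (b, i) = (b₀, i₀) ∧ j = Fin.last L := by
      simpa [tip, Prod.ext_iff, and_assoc] using hx
    rw [← h, hσ] at hx'
    refine ⟨some ⟨i, Fin.castAdd _ (Fin.last L)⟩, subdividedClaw_adj_some.2 ⟨rfl, Or.inr ?_⟩,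
      hx' ▸ unfoldClaw_castAdd ..⟩
    simp

theorem memS_of_isContained_linkedClaws (hσ : Function.Involutive σ) (hne : ∀ h, (σ h).1 ≠ h.1)
    {W : Type u} [Finite W] {H : SimpleGraph W} (hL : Nat.card W ≤ L + 1)
    (h : H ⊑ linkedClaws σ L) : MemS H := by
  intro C
  obtain ⟨f⟩ := IsContained.trans ⟨Copy.induce H C.supp⟩ h
  obtain ⟨x⟩ := C.connected_toSimpleGraph.nonempty
  let T := clawForest fun _ => (L + 1) + (L + 1)
  have hcard : Nat.card C.supp ≤ L + 1 := (Finite.card_subtype_le _).trans hL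
  refine isPathGraph_or_isSubdividedClaw C.connected_toSimpleGraph <|
    isContained_of_forall_lift (unfoldClaw_injective hσ.injective hne (f x).1)
      (fun s t h => T.depth_le_depth_add_one (by rwa [← subdividedClaw_eq_graph_clawForest]))
      (fun _ _ => exists_unfoldClaw_eq_of_adj hσ) C.connected_toSimpleGraph f
      (unfoldClaw_clawEmbedding (f x).1 (f x).2) (Nat.add_le_add ?_ hcard)
  obtain ⟨b, _ | ⟨_, j⟩⟩ := f x
  · exact Nat.zero_le _
  · exact j.2

end LinkedClaws

/-! ### Claws linked along a grid -/

section Grid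

variable {k : ℕ}

/-- The links of the toroidal grid with `k + 2` rows and columns, in which every vertex has been
split in two so that all degrees are at most three: `(false, i, j)` is the `j`-th vertex of the
`i`-th row, `(true, j, i)` is the `i`-th vertex of the `j`-th column, and these two are linked. -/
def gridLink (k : ℕ) : (Bool × Fin (k + 2) × Fin (k + 2)) × Fin 3 →
    (Bool × Fin (k + 2) × Fin (k + 2)) × Fin 3
  | ((s, i, j), 0) => ((s, i, j + 1), 1)
  | ((s, i, j), 1) => ((s, i, j - 1), 0)
  | ((s, i, j), 2) => ((!s, j, i), 2)

theorem gridLink_involutive (k : ℕ) : Function.Involutive (gridLink k) := by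
  rintro ⟨⟨s, i, j⟩, a⟩
  fin_cases a <;> simp [gridLink]

theorem gridLink_fst_ne (h) : (gridLink k h).1 ≠ h.1 := by
  obtain ⟨⟨s, i, j⟩, a⟩ := h
  fin_cases a <;> simp [gridLink]

theorem linkGraph_gridLink_adj (h) : (linkGraph (gridLink k)).Adj h.1 (gridLink k h).1 :=
  iSup_adj.2 ⟨h, (edge_adj ..).2 ⟨Or.inl ⟨rfl, rfl⟩, (gridLink_fst_ne h).symm⟩⟩

/-- The vertices of the row (if `s = false`) or column (if `s = true`) with index `i`. -/
def gridLine (s : Bool) (i : Fin (k + 2)) : Set (Bool × Fin (k + 2) × Fin (k + 2)) :=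
  {b | (b.1, b.2.1) = (s, i)}

theorem linkGraph_induce_gridLine_connected (s : Bool) (i : Fin (k + 2)) :
    ((linkGraph (gridLink k)).induce (gridLine s i)).Connected := by
  let vertex (j : Fin (k + 2)) : gridLine (k := k) s i := ⟨(s, i, j), rfl⟩
  have hreach (j : Fin (k + 2)) :
      ((linkGraph (gridLink k)).induce (gridLine s i)).Reachable (vertex 0) (vertex j) := by
    induction j using Fin.induction with
    | zero => exact Reachable.refl _
    | succ j ih =>
      have hadj := linkGraph_gridLink_adj ((s, i, j.castSucc), 0)
      rw [gridLink, Fin.coeSucc_eq_succ] at hadj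
      exact ih.trans (Adj.reachable hadj)
  refine connected_iff_exists_forall_reachable _ |>.2 ⟨vertex 0, ?_⟩
  rintro ⟨⟨_, _, j⟩, ⟨⟩⟩
  exact hreach j

theorem linkGraph_induce_cross_connected (i j : Fin (k + 2)) :
    ((linkGraph (gridLink k)).induce (gridLine false i ∪ gridLine true j)).Connected :=
  connected_induce_union (v := (false, i, j)) (w := (true, j, i))
    (linkGraph_induce_gridLine_connected _ _).preconnected
    (linkGraph_induce_gridLine_connected _ _).preconnected rfl rfl
    (linkGraph_gridLink_adj ((false, i, j), 2))

theorem isBramble_cross (L : ℕ) :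
    IsBramble (linkedClaws (gridLink k) L) fun a : Fin (k + 2) × Fin (k + 2) =>
      {x | x.1 ∈ gridLine false a.1 ∪ gridLine true a.2} where
  connected a := linkedClaws_induce_connected (gridLink_involutive k) gridLink_fst_ne
    (linkGraph_induce_cross_connected a.1 a.2)
  touch a a' := ⟨tip L ((false, a.1, a'.2), 2), Or.inl rfl, tip L ((true, a'.2, a.1), 2),
    Or.inr rfl, Or.inr (linkedClaws_adj_tip gridLink_fst_ne ((false, a.1, a'.2), 2))⟩

theorem lt_treewidth_linkedClaws_gridLink (k L : ℕ) :
    k < treewidth (linkedClaws (gridLink k) L) := by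
  classical
  refine (isBramble_cross L).le_treewidth fun X hX => ?_
  by_contra! hcard
  have hmiss (s : Bool) : ∃ i : Fin (k + 2), ∀ x ∈ X, x.1 ∉ gridLine s i := by
    by_contra! hmeet
    choose x hxX hx using hmeet
    have hinj : Function.Injective x := fun i i' h => by
      have hsi : (s, i) = (s, i') := (hx i).symm.trans (h ▸ hx i')
      exact (Prod.mk.inj hsi).2
    have := Finset.card_le_card_of_injOn x (s := Finset.univ) (fun i _ => hxX i) hinj.injOn
    rw [Finset.card_fin] at this
    omega
  obtain ⟨i, hi⟩ := hmiss false
  obtain ⟨j, hj⟩ := hmiss true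
  obtain ⟨x, hx, h | h⟩ := hX (i, j)
  exacts [hi x hx h, hj x hx h]

theorem memS_of_hasBoundedTreewidth {W : Type u} [Finite W] {H : SimpleGraph W}
    (hH : HasBoundedTreewidth (subgraphFree H)) : MemS H := by
  obtain ⟨c, hc⟩ := hH
  let G := linkedClaws (gridLink c) (Nat.card W)
  let e : G.comap Equiv.ulift.{u} ≃g G := Iso.comap Equiv.ulift G
  refine memS_of_isContained_linkedClaws (gridLink_involutive c) gridLink_fst_ne
    (Nat.le_succ (Nat.card W)) ?_
  by_contra hfree
  exact (lt_treewidth_linkedClaws_gridLink c (Nat.card W)).not_ge <|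
    (treewidth_le_of_iso e).trans (hc _ _ fun h => hfree (h.trans ⟨e.toCopy⟩))

end Grid

/-! ### The clique number -/

theorem cliqueNum_lt_of_free {W : Type v} [Finite W] {H : SimpleGraph W} {V : Type w}
    {G : SimpleGraph V} (hG : H.Free G) : G.cliqueNum < Nat.card W := by
  by_contra! hle
  obtain ⟨s, hs⟩ := G.exists_isNClique_cliqueNum
  have := Fintype.ofFinite W
  obtain ⟨g⟩ : Nonempty (W ↪ s) := Function.Embedding.nonempty_of_card_le <| by
    rwa [Fintype.card_coe, hs.card_eq, ← Nat.card_eq_fintype_card]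
  exact hG ⟨⟨⟨fun w => g w, fun hab => hs.isClique (g _).2 (g _).2 fun h =>
    hab.ne (g.injective (Subtype.ext h))⟩, Subtype.val_injective.comp g.injective⟩⟩

theorem hasBoundedTreewidth_of_isTwOmegaBounded {W : Type u} [Finite W] {H : SimpleGraph W}
    (hH : IsTwOmegaBounded (subgraphFree H)) : HasBoundedTreewidth (subgraphFree H) := by
  obtain ⟨f, hf⟩ := hH
  refine ⟨(Finset.range (Nat.card W)).sup f, fun V _ G hG => ?_⟩
  have hfree : H.Free (G.induce Set.univ) := fun h => hG (h.trans ⟨Copy.induce G _⟩)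
  exact (treewidth_le_of_iso (induceUnivIso G)).trans <| (hf V G hG Set.univ).trans <|
    Finset.le_sup (Finset.mem_range.2 (cliqueNum_lt_of_free hfree))

theorem isTwOmegaBounded_of_hasBoundedTreewidth {W : Type u} {H : SimpleGraph W}
    (hH : HasBoundedTreewidth (subgraphFree H)) : IsTwOmegaBounded (subgraphFree H) := by
  obtain ⟨c, hc⟩ := hH
  exact ⟨fun _ => c, fun V _ G hG s => hc _ _ fun h => hG (h.trans ⟨Copy.induce G s⟩)⟩

end TwOmega

theorem mainTheorem6 {W : Type*} [Finite W] (H : SimpleGraph W) :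
    List.TFAE
      [TwOmega.IsTwOmegaBounded (TwOmega.subgraphFree H),
        TwOmega.HasBoundedTreewidth (TwOmega.subgraphFree H),
        TwOmega.MemS H] := by
  tfae_have 1 → 2 := TwOmega.hasBoundedTreewidth_of_isTwOmegaBounded
  tfae_have 2 → 1 := TwOmega.isTwOmegaBounded_of_hasBoundedTreewidth
  tfae_have 2 → 3 := TwOmega.memS_of_hasBoundedTreewidth
  tfae_have 3 → 2 := TwOmega.hasBoundedTreewidth_of_memS
  tfae_finish
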